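/- Let $n\ge 1$, let $\Omega\subset\mathbb R^n$ be a bounded open set and let $p\ge 1$ be real (no restriction $p<n$). For a weakly differentiable function $f$ on $\mathbb R^n$ put $\nabla_\xi f(x)=\langle\nabla f(x),\xi\rangle$ and $$\mathcal E_p f=c_{n,p}\Big(\int_{\mathbb S^{n-1}}\|\nabla_\xi f\|_{L^p(\mathbb R^n)}^{-n}\,d\xi\Big)^{-1/n},\qquad c_{n,p}=(n\omega_n)^{1/n}\Big(\frac{n\,\omega_n\,\omega_{p-1}}{2\,\omega_{n+p-2}}\Big)^{1/p},\qquad \omega_k=\frac{\pi^{k/2}}{\Gamma(k/2+1)},$$ with the conventions $0^{-n}=\infty$ and $\infty^{-1/n}=0$, so that $\mathcal E_p 0=0$. Then the affine $L^p$ Poincaré inequality holds: there is a constant $K(p,\Omega)>0$, depending only on $p$ and $\Omega$, such that $$K(p,\Omega)\int_\Omega |f|^p\,dx\le(\mathcal E_p f)^p$$ for every $f\in W^{1,p}_0(\Omega)$, where $W^{1,p}_0(\Omega)$ is the closure of $C_c^\infty(\Omega)$ in $W^{1,p}(\mathbb R^n)$ (functions being extended by zero outside $\Omega$), and also for every $f\in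 W^{1,p}(\mathbb R^n)$ with $f=0$ almost everywhere on $\mathbb R^n\setminus\Omega$. Here $W^{1,p}(\mathbb R^n)$ is the space of $f\in L^p(\mathbb R^n)$ with weak gradient $\nabla f\in L^p(\mathbb R^n;\mathbb R^n)$. -/

import Mathlib

open MeasureTheory Filter Topology
open scoped ENNReal ContDiff InnerProductSpace

namespace AffinePoincare

/-- `ω_k = π^{k/2} / Γ(k/2 + 1)`, the volume of the unit ball of `ℝ^k`, for real `k ≥ 0`. -/
noncomputable def ballVol (k : ℝ) : ℝ :=
  Real.pi ^ (k / 2) / Real.Gamma (k / 2 + 1)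

/-- The normalizing constant
`c_{n,p} = (n ω_n)^{1/n} (n ω_n ω_{p-1} / (2 ω_{n+p-2}))^{1/p}`. -/
noncomputable def normConst (n : ℕ) (p : ℝ) : ℝ :=
  (n * ballVol n) ^ (1 / (n : ℝ)) *
    (n * ballVol n * ballVol (p - 1) / (2 * ballVol (n + p - 2))) ^ (1 / p)

/-- `‖∇_ξ f‖_p`, the `L^p(ℝⁿ)` norm of `x ↦ ⟨∇f(x), ξ⟩`, for a function with gradient `∇f = g`. -/
noncomputable def dirNorm {n : ℕ} (p : ℝ)
    (g : EuclideanSpace ℝ (Fin n) → EuclideanSpace ℝ (Fin n)) (ξ : EuclideanSpace ℝ (Fin n)) :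
    ℝ≥0∞ :=
  eLpNorm (fun x => ⟪g x, ξ⟫_ℝ) (ENNReal.ofReal p) volume

/-- The affine energy
`𝓔_p f = c_{n,p} (∫_{S^{n-1}} ‖∇_ξ f‖_p^{-n} dξ)^{-1/n}` of a function `f` with weak gradient
`∇f = g`. Values are in `[0, ∞]`, with `0^{-n} = ∞` and `∞^{-1/n} = 0`; `dξ` is the surface measure
of the unit sphere. -/
noncomputable def affineEnergy {n : ℕ} (p : ℝ)
    (g : EuclideanSpace ℝ (Fin n) → EuclideanSpace ℝ (Fin n)) : ℝ≥0∞ :=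
  ENNReal.ofReal (normConst n p) *
    (∫⁻ ξ : Metric.sphere (0 : EuclideanSpace ℝ (Fin n)) 1,
      dirNorm p g (ξ : EuclideanSpace ℝ (Fin n)) ^ (-(n : ℝ))
        ∂(volume : Measure (EuclideanSpace ℝ (Fin n))).toSphere) ^ (-(1 / (n : ℝ)))

/-- `g` is a weak gradient of `f` on `ℝⁿ`: for every test function `φ ∈ C_c^∞(ℝⁿ)` and every
direction `v`, `∫ f ∂_v φ = - ∫ ⟨g, v⟩ φ`. -/
def HasWeakGradient {n : ℕ} (f : EuclideanSpace ℝ (Fin n) → ℝ)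
    (g : EuclideanSpace ℝ (Fin n) → EuclideanSpace ℝ (Fin n)) : Prop :=
  ∀ φ : EuclideanSpace ℝ (Fin n) → ℝ, ContDiff ℝ ∞ φ → HasCompactSupport φ →
    ∀ v : EuclideanSpace ℝ (Fin n),
      ∫ x, f x * fderiv ℝ φ x v = -∫ x, ⟪g x, v⟫_ℝ * φ x

/-- `f ∈ W^{1,p}(ℝⁿ)` with weak gradient `g`. -/
structure IsW1p {n : ℕ} (p : ℝ) (f : EuclideanSpace ℝ (Fin n) → ℝ)
    (g : EuclideanSpace ℝ (Fin n) → EuclideanSpace ℝ (Fin n)) : Prop where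
  memLp : MemLp f (ENNReal.ofReal p) volume
  memLp_grad : MemLp g (ENNReal.ofReal p) volume
  weakGrad : HasWeakGradient f g

/-- `f ∈ W^{1,p}_0(Ω)` with weak gradient `g`: `f` (extended by zero) is a limit in `W^{1,p}` of
smooth functions with compact support in `Ω`. -/
structure IsW1pZero {n : ℕ} (Ω : Set (EuclideanSpace ℝ (Fin n))) (p : ℝ)
    (f : EuclideanSpace ℝ (Fin n) → ℝ)
    (g : EuclideanSpace ℝ (Fin n) → EuclideanSpace ℝ (Fin n)) : Prop extends IsW1p p f g where
  exists_approx : ∃ φ : ℕ → EuclideanSpace ℝ (Fin n) → ℝ,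
    (∀ k, ContDiff ℝ ∞ (φ k) ∧ HasCompactSupport (φ k) ∧ tsupport (φ k) ⊆ Ω) ∧
    Tendsto (fun k => eLpNorm (fun x => φ k x - f x) (ENNReal.ofReal p) volume) atTop (𝓝 0) ∧
    Tendsto (fun k => eLpNorm (fun x => gradient (φ k) x - g x) (ENNReal.ofReal p) volume)
      atTop (𝓝 0)

/-- `f ∈ W^{1,p}(ℝⁿ)` with weak gradient `g`, and `f = 0` almost everywhere on `ℝⁿ ∖ Ω`. -/
structure IsW1pVanishing {n : ℕ} (Ω : Set (EuclideanSpace ℝ (Fin n))) (p : ℝ)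
    (f : EuclideanSpace ℝ (Fin n) → ℝ)
    (g : EuclideanSpace ℝ (Fin n) → EuclideanSpace ℝ (Fin n)) : Prop extends IsW1p p f g where
  ae_eq_zero : ∀ᵐ x ∂volume, x ∉ Ω → f x = 0

end AffinePoincare

/-! The affine energy sees only the directional norms, so it suffices to bound them below uniformly
over unit `ξ`. If `Ω` lies in a ball of radius `R`, every point of the ball leaves it after moving
`2R` along `ξ`, so `f(x)` is minus the integral of `∇_ξ f` over that segment. Minkowski's inequality
then gives `‖f‖_p ≤ 2R ‖∇_ξ f‖_p`, with a constant free of `ξ` (`eLpNorm_le_mul_eLpNorm_weakDeriv`).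
Since the spherical average is monotone in the directional norms and the sphere has finite area,
this passes to the energy (`le_affineEnergy`). No Sobolev embedding enters, hence no condition `p <
n`.

The segment formula is obtained by duality, by differentiating the pairing of `f` with translates of
a test function; no approximation of `f` is needed. Both function spaces are thus handled at once,
the closure being contained in the vanishing class. -/

namespace AffinePoincare

/-! ### Directional Poincaré inequality along a unit vector -/

section Directional

variable {E : Type*} [NormedAddCommGroup E] [NormedSpace ℝ E] [MeasurableSpace E] [BorelSpace E]
  {μ : Measure E}

/-- If the weak derivative of `f` in direction `ξ` is `h`, and the translates of the test function
`φ` along `ξ` leave the support of `f` at time `T`, then `∫ f φ` is minus the time integral of the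
pairing of `h` with the translates. -/
theorem integral_mul_eq_neg_intervalIntegral {f h : E → ℝ} {ξ : E} (hf : Integrable f μ)
    (hweak : ∀ φ : E → ℝ, ContDiff ℝ ∞ φ → HasCompactSupport φ →
      ∫ x, f x * fderiv ℝ φ x ξ ∂μ = -∫ x, h x * φ x ∂μ)
    {φ : E → ℝ} (hφ : ContDiff ℝ ∞ φ) (hφc : HasCompactSupport φ) {T : ℝ}
    (hT : ∫ x, f x * φ (x - T • ξ) ∂μ = 0) :
    ∫ x, f x * φ x ∂μ = -∫ s in (0 : ℝ)..T, ∫ x, h x * φ (x - s • ξ) ∂μ := by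
  have hφ1 : ContDiff ℝ 1 φ := hφ.of_le (by exact_mod_cast le_top)
  have hd : Continuous (fun x => fderiv ℝ φ x ξ) :=
    (hφ1.continuous_fderiv one_ne_zero).clm_apply continuous_const
  have hdc : HasCompactSupport (fun x => fderiv ℝ φ x ξ) := hφc.fderiv_apply (𝕜 := ℝ) ξ
  obtain ⟨C, hC⟩ := hdc.exists_bound_of_continuous hd
  obtain ⟨C₀, hC₀⟩ := hφc.exists_bound_of_continuous hφ.continuous
  have hderiv (s : ℝ) : HasDerivAt (fun s : ℝ => ∫ x, f x * φ (x - s • ξ) ∂μ)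
      (∫ x, f x * -fderiv ℝ φ (x - s • ξ) ξ ∂μ) s := by
    refine (hasDerivAt_integral_of_dominated_loc_of_deriv_le
      (F := fun (s : ℝ) x => f x * φ (x - s • ξ))
      (F' := fun (s : ℝ) x => f x * -fderiv ℝ φ (x - s • ξ) ξ)
      (bound := fun x => ‖f x‖ * C) Filter.univ_mem ?_ ?_ ?_ ?_ (hf.norm.mul_const C) ?_).2
    · exact .of_forall fun s => hf.1.mul
        (hφ.continuous.comp (by fun_prop : Continuous fun x => x - s • ξ)).aestronglyMeasurable
    · exact hf.mul_bdd (c := C₀)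
        (hφ.continuous.comp (by fun_prop : Continuous fun x => x - s • ξ)).aestronglyMeasurable
        (.of_forall fun x => hC₀ _)
    · exact hf.1.mul
        (hd.comp (by fun_prop : Continuous fun x => x - s • ξ)).neg.aestronglyMeasurable
    · refine .of_forall fun x s _ => ?_
      rw [norm_mul, norm_neg]
      gcongr
      exact hC _
    · refine .of_forall fun x s _ => HasDerivAt.const_mul _ ?_
      have h1 : HasDerivAt (fun s : ℝ => x - s • ξ) (-ξ) s := by
        simpa using ((hasDerivAt_id s).smul_const ξ).const_sub x
      have h2 := ((hφ1.differentiable one_ne_zero) (x - s • ξ)).hasFDerivAt.comp_hasDerivAt s h1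
      rw [map_neg] at h2
      exact h2
  have hcont : Continuous (fun s : ℝ => ∫ x, f x * -fderiv ℝ φ (x - s • ξ) ξ ∂μ) := by
    refine continuous_of_dominated (bound := fun x => ‖f x‖ * C) (fun s => ?_) (fun s => ?_)
      (hf.norm.mul_const C) (.of_forall fun x => ?_)
    · exact hf.1.mul
        (hd.comp (by fun_prop : Continuous fun x => x - s • ξ)).neg.aestronglyMeasurable
    · refine .of_forall fun x => ?_
      rw [norm_mul, norm_neg]
      gcongr
      exact hC _
    · exact continuous_const.mul
        (hd.comp (by fun_prop : Continuous fun s : ℝ => x - s • ξ)).neg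
  have hFTC := intervalIntegral.integral_eq_sub_of_hasDerivAt (a := 0) (b := T)
    (fun s _ => hderiv s) (hcont.intervalIntegrable _ _)
  -- Translates of `φ` are again test functions, so the weak derivative identity applies to each.
  have hpair (s : ℝ) : ∫ x, f x * -fderiv ℝ φ (x - s • ξ) ξ ∂μ =
      ∫ x, h x * φ (x - s • ξ) ∂μ := by
    have := hweak (fun x => φ (x - s • ξ)) (hφ.comp (contDiff_id.sub contDiff_const))
      (hφc.comp_homeomorph (Homeomorph.subRight (s • ξ)))
    simp only [fderiv_comp_sub] at this
    simp only [mul_neg, integral_neg, this, neg_neg]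
  simp only [hpair, hT, zero_smul, sub_zero, zero_sub] at hFTC
  linarith

variable [FiniteDimensional ℝ E] [μ.IsAddHaarMeasure]

/-- The shear `(s, y) ↦ (s, y + s • ξ)` preserves the product measure. This justifies Fubini for the
segment integrals. -/
theorem integrable_translate_prod {h : E → ℝ} (hh : Integrable h μ) (ξ : E) (T : ℝ) :
    Integrable (fun z : ℝ × E => h (z.2 + z.1 • ξ))
      ((volume.restrict (Set.Ioc 0 T)).prod μ) := by
  have hmp : MeasurePreserving (fun z : ℝ × E => (z.1, z.2 + z.1 • ξ))
      ((volume.restrict (Set.Ioc 0 T)).prod μ) ((volume.restrict (Set.Ioc 0 T)).prod μ) :=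
    (MeasurePreserving.id _).skew_product (g := fun (s : ℝ) (y : E) => y + s • ξ)
      (by fun_prop) (.of_forall fun s => map_add_right_eq_self μ (s • ξ))
  exact hmp.integrable_comp_of_integrable (g := fun z : ℝ × E => h z.2) (hh.comp_snd _)

/-- Minkowski's integral inequality for the integrals of `h` along segments in direction `ξ`. -/
theorem eLpNorm_integral_translate_le {h : E → ℝ} (hh : Measurable h) (ξ : E) {T : ℝ}
    (hT : 0 ≤ T) {p : ℝ} (hp : 1 ≤ p) :
    eLpNorm (fun x => ∫ s in (0 : ℝ)..T, h (x + s • ξ)) (ENNReal.ofReal p) μ ≤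
      ENNReal.ofReal T * eLpNorm h (ENNReal.ofReal p) μ := by
  have hp0 : 0 < p := by linarith
  have hpE : ENNReal.ofReal p ≠ 0 := by simpa using hp0
  set ν : Measure ℝ := volume.restrict (Set.Ioc 0 T) with hν
  have hνu : ν Set.univ = ENNReal.ofReal T := by simp [hν]
  -- Hölder on an interval of length `T`; the remaining factor `T` comes from integrating over `s`
  -- after translation invariance.
  have hpoint (x : E) : ‖∫ s in (0 : ℝ)..T, h (x + s • ξ)‖ₑ ^ p ≤
      ENNReal.ofReal T ^ (p - 1) * ∫⁻ s, ‖h (x + s • ξ)‖ₑ ^ p ∂ν := by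
    have hm : AEStronglyMeasurable (fun s : ℝ => h (x + s • ξ)) ν :=
      (hh.comp (by fun_prop)).aestronglyMeasurable
    have h1 := eLpNorm_le_eLpNorm_mul_rpow_measure_univ
      (show (1 : ℝ≥0∞) ≤ ENNReal.ofReal p by simpa using hp) hm
    rw [eLpNorm_one_eq_lintegral_enorm, eLpNorm_eq_lintegral_rpow_enorm_toReal hpE
      ENNReal.ofReal_ne_top, hνu, ENNReal.toReal_ofReal hp0.le, ENNReal.toReal_one] at h1
    rw [intervalIntegral.integral_of_le hT]
    calc _ ≤ (∫⁻ s, ‖h (x + s • ξ)‖ₑ ∂ν) ^ p := by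
          gcongr
          exact enorm_integral_le_lintegral_enorm _
      _ ≤ _ := ENNReal.rpow_le_rpow h1 hp0.le
      _ = _ := by
          rw [ENNReal.mul_rpow_of_nonneg _ _ hp0.le, ← ENNReal.rpow_mul, ← ENNReal.rpow_mul,
            one_div_mul_cancel hp0.ne', ENNReal.rpow_one, mul_comm]
          congr 2
          field_simp
  have hint : ∫⁻ x, ‖∫ s in (0 : ℝ)..T, h (x + s • ξ)‖ₑ ^ p ∂μ ≤
      ENNReal.ofReal T ^ p * ∫⁻ x, ‖h x‖ₑ ^ p ∂μ := by
    calc _ ≤ ∫⁻ x, ENNReal.ofReal T ^ (p - 1) * ∫⁻ s, ‖h (x + s • ξ)‖ₑ ^ p ∂ν ∂μ :=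
          lintegral_mono hpoint
      _ = ENNReal.ofReal T ^ (p - 1) * ∫⁻ s, ∫⁻ x, ‖h (x + s • ξ)‖ₑ ^ p ∂μ ∂ν := by
          rw [lintegral_const_mul' _ _ (ENNReal.rpow_ne_top_of_nonneg (by linarith)
            ENNReal.ofReal_ne_top), lintegral_lintegral_swap]
          exact Measurable.aemeasurable (by
            simp only [Function.uncurry_def]
            exact ((hh.comp (by fun_prop : Measurable fun z : E × ℝ => z.1 + z.2 • ξ)).enorm).pow_const p)
      _ = ENNReal.ofReal T ^ (p - 1) * (ENNReal.ofReal T * ∫⁻ x, ‖h x‖ₑ ^ p ∂μ) := by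
          congr 1
          simp_rw [fun s : ℝ => lintegral_add_right_eq_self (μ := μ) (fun x => ‖h x‖ₑ ^ p) (s • ξ)]
          rw [lintegral_const, hνu, mul_comm]
      _ = _ := by
          rw [← mul_assoc]
          congr 1
          nth_rw 2 [← ENNReal.rpow_one (ENNReal.ofReal T)]
          rw [← ENNReal.rpow_add_of_nonneg _ _ (by linarith) zero_le_one, sub_add_cancel]
  rw [eLpNorm_eq_lintegral_rpow_enorm_toReal hpE ENNReal.ofReal_ne_top,
    eLpNorm_eq_lintegral_rpow_enorm_toReal hpE ENNReal.ofReal_ne_top, ENNReal.toReal_ofReal hp0.le]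
  calc _ ≤ _ := ENNReal.rpow_le_rpow hint (by positivity)
    _ = _ := by
        rw [ENNReal.mul_rpow_of_nonneg _ _ (by positivity), ← ENNReal.rpow_mul,
          mul_one_div_cancel hp0.ne', ENNReal.rpow_one]

/-- A function vanishing outside `ball 0 R` with weak derivative `h` in the unit direction `ξ` is
on that ball minus the integral of `h` along segments of length `2R`. -/
theorem ae_eq_neg_integral_translate {f h : E → ℝ} {ξ : E} (hξ : ‖ξ‖ = 1) {R : ℝ}
    (hf : Integrable f μ) (hfR : ∀ᵐ x ∂μ, x ∉ Metric.ball (0 : E) R → f x = 0)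
    (hh : LocallyIntegrable h μ)
    (hweak : ∀ φ : E → ℝ, ContDiff ℝ ∞ φ → HasCompactSupport φ →
      ∫ x, f x * fderiv ℝ φ x ξ ∂μ = -∫ x, h x * φ x ∂μ) :
    ∀ᵐ x ∂μ, x ∈ Metric.ball (0 : E) R → f x = -∫ s in (0 : ℝ)..(2 * R),
      (Metric.closedBall (0 : E) (3 * R)).indicator h (x + s • ξ) := by
  rcases le_or_gt R 0 with hR | hR
  · simp [Metric.ball_eq_empty.2 hR]
  -- Truncation makes `h` globally integrable. It goes unnoticed from the ball of radius `R`, since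
  -- `R + 2R = 3R`.
  set H := (Metric.closedBall (0 : E) (3 * R)).indicator h with hH
  have hHint : Integrable H μ :=
    (hh.integrableOn_isCompact (isCompact_closedBall _ _)).integrable_indicator
      Metric.isClosed_closedBall.measurableSet
  have hprod := integrable_translate_prod hHint ξ (2 * R)
  have hG : Integrable (fun x => ∫ s in (0 : ℝ)..(2 * R), H (x + s • ξ)) μ := by
    simp_rw [intervalIntegral.integral_of_le (by linarith : (0 : ℝ) ≤ 2 * R)]
    exact hprod.integral_prod_right
  have key : ∀ᵐ x ∂μ, x ∈ Metric.ball (0 : E) R →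
      f x + ∫ s in (0 : ℝ)..(2 * R), H (x + s • ξ) = 0 := by
    refine Metric.isOpen_ball.ae_eq_zero_of_integral_contDiff_smul_eq_zero
      ((hf.add hG).locallyIntegrable.locallyIntegrableOn _) fun φ hφ hφc hφR => ?_
    have hφ0 (x : E) (hx : R ≤ ‖x‖) : φ x = 0 := by
      by_contra h0
      have := hφR (subset_tsupport φ h0)
      rw [mem_ball_zero_iff] at this
      linarith
    obtain ⟨C₀, hC₀⟩ := hφc.exists_bound_of_continuous hφ.continuous
    -- For `‖x‖ < R` the point `x - 2R ξ` has norm above `R`, outside the support of `φ`.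
    have hT : ∫ x, f x * φ (x - (2 * R) • ξ) ∂μ = 0 := by
      refine integral_eq_zero_of_ae ?_
      filter_upwards [hfR] with x hx
      by_cases hxR : x ∈ Metric.ball (0 : E) R
      · rw [mem_ball_zero_iff] at hxR
        have h1 := norm_sub_norm_le ((2 * R) • ξ) x
        rw [norm_smul, hξ, Real.norm_of_nonneg (by linarith), norm_sub_rev] at h1
        simp [hφ0 (x - (2 * R) • ξ) (by linarith)]
      · simp [hx hxR]
    have h1 := integral_mul_eq_neg_intervalIntegral hf hweak hφ hφc hT
    have h2 : ∫ s in (0 : ℝ)..(2 * R), ∫ x, h x * φ (x - s • ξ) ∂μ =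
        ∫ s in (0 : ℝ)..(2 * R), ∫ x, H (x + s • ξ) * φ x ∂μ := by
      refine intervalIntegral.integral_congr fun s hs => ?_
      rw [Set.uIcc_of_le (by linarith)] at hs
      have h3 : ∫ x, H (x + s • ξ) * φ x ∂μ = ∫ x, H x * φ (x - s • ξ) ∂μ := by
        simpa using integral_add_right_eq_self (μ := μ) (fun x => H x * φ (x - s • ξ)) (s • ξ)
      simp only [h3]
      congr 1
      ext x
      by_cases hx : x ∈ Metric.closedBall (0 : E) (3 * R)
      · simp [hH, hx]
      · rw [mem_closedBall_zero_iff, not_le] at hx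
        have h4 := norm_sub_norm_le x (s • ξ)
        rw [norm_smul, hξ, Real.norm_of_nonneg hs.1] at h4
        simp [hφ0 (x - s • ξ) (by linarith [hs.2])]
    have h5 : ∫ s in (0 : ℝ)..(2 * R), ∫ x, H (x + s • ξ) * φ x ∂μ =
        ∫ x, (∫ s in (0 : ℝ)..(2 * R), H (x + s • ξ)) * φ x ∂μ := by
      simp_rw [intervalIntegral.integral_of_le (by linarith : (0 : ℝ) ≤ 2 * R)]
      rw [integral_integral_swap]
      · simp_rw [integral_mul_const]
      · exact hprod.mul_bdd (c := C₀)
          (hφ.continuous.comp continuous_snd).aestronglyMeasurable (.of_forall fun z => hC₀ _)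
    have hfi : Integrable (fun x => f x * φ x) μ :=
      hf.mul_bdd (c := C₀) hφ.continuous.aestronglyMeasurable (.of_forall hC₀)
    have hGi : Integrable (fun x => (∫ s in (0 : ℝ)..(2 * R), H (x + s • ξ)) * φ x) μ :=
      hG.mul_bdd (c := C₀) hφ.continuous.aestronglyMeasurable (.of_forall hC₀)
    simp only [smul_eq_mul, mul_comm (φ _), add_mul]
    rw [integral_add hfi hGi, h1, h2, h5, neg_add_cancel]
  filter_upwards [key] with x hx hxR
  linarith [hx hxR]

/-- Directional Poincaré inequality, with a constant independent of the direction. -/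
theorem eLpNorm_le_mul_eLpNorm_weakDeriv {f h : E → ℝ} {ξ : E} (hξ : ‖ξ‖ = 1) {R : ℝ}
    (hR : 0 ≤ R) {p : ℝ} (hp : 1 ≤ p) (hf : MemLp f (ENNReal.ofReal p) μ)
    (hfR : ∀ᵐ x ∂μ, x ∉ Metric.ball (0 : E) R → f x = 0)
    (hh : MemLp h (ENNReal.ofReal p) μ)
    (hweak : ∀ φ : E → ℝ, ContDiff ℝ ∞ φ → HasCompactSupport φ →
      ∫ x, f x * fderiv ℝ φ x ξ ∂μ = -∫ x, h x * φ x ∂μ) :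
    eLpNorm f (ENNReal.ofReal p) μ ≤
      ENNReal.ofReal (2 * R) * eLpNorm h (ENNReal.ofReal p) μ := by
  have hp' : (1 : ℝ≥0∞) ≤ ENNReal.ofReal p := by simpa using hp
  -- Minkowski's inequality above is stated for genuinely measurable functions.
  obtain ⟨k, hk, hhk⟩ := hh.1.aemeasurable
  have hkp : MemLp k (ENNReal.ofReal p) μ := hh.ae_eq hhk
  have hweak' (φ : E → ℝ) (h1 : ContDiff ℝ ∞ φ) (h2 : HasCompactSupport φ) :
      ∫ x, f x * fderiv ℝ φ x ξ ∂μ = -∫ x, k x * φ x ∂μ := by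
    rw [hweak φ h1 h2]
    congr 1
    refine integral_congr_ae ?_
    filter_upwards [hhk] with x hx
    rw [hx]
  have hfi : Integrable f μ := by
    have h1 : IntegrableOn f (Metric.ball 0 R) μ :=
      ((hf.locallyIntegrable hp').integrableOn_isCompact (isCompact_closedBall 0 R)).mono_set
        Metric.ball_subset_closedBall
    refine h1.integrable_of_ae_notMem_eq_zero hfR
  have hae := ae_eq_neg_integral_translate hξ hfi hfR (hkp.locallyIntegrable hp') hweak'
  have hHm : Measurable ((Metric.closedBall (0 : E) (3 * R)).indicator k) :=
    hk.indicator Metric.isClosed_closedBall.measurableSet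
  calc eLpNorm f (ENNReal.ofReal p) μ
      ≤ eLpNorm (fun x => ∫ s in (0 : ℝ)..(2 * R),
          (Metric.closedBall (0 : E) (3 * R)).indicator k (x + s • ξ)) (ENNReal.ofReal p) μ := by
        refine eLpNorm_mono_ae ?_
        filter_upwards [hae, hfR] with x h1 h2
        by_cases hx : x ∈ Metric.ball (0 : E) R
        · rw [h1 hx, norm_neg]
        · simp [h2 hx]
    _ ≤ _ := eLpNorm_integral_translate_le hHm ξ (by linarith) hp
    _ ≤ _ := by
        gcongr
        exact (eLpNorm_indicator_le _).trans (eLpNorm_congr_ae hhk).ge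

end Directional

/-! ### From directional bounds to the affine energy -/

theorem ballVol_pos {k : ℝ} (hk : -2 < k) : 0 < ballVol k :=
  div_pos (Real.rpow_pos_of_pos Real.pi_pos _) (Real.Gamma_pos_of_pos (by linarith))

theorem normConst_pos {n : ℕ} (hn : 1 ≤ n) {p : ℝ} (hp : 1 ≤ p) : 0 < normConst n p := by
  have hn' : (1 : ℝ) ≤ n := by exact_mod_cast hn
  have h1 := ballVol_pos (k := n) (by linarith)
  have h2 := ballVol_pos (k := p - 1) (by linarith)
  have h3 := ballVol_pos (k := n + p - 2) (by linarith)
  unfold normConst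
  positivity

/-- A lower bound on the directional norms over the sphere bounds the affine energy below. -/
theorem le_affineEnergy {n : ℕ} (hn : 1 ≤ n) {p : ℝ}
    {g : EuclideanSpace ℝ (Fin n) → EuclideanSpace ℝ (Fin n)} {a : ℝ≥0∞} (ha : a ≠ ⊤) {M : ℝ}
    (hM : 0 < M)
    (hσ : (volume : Measure (EuclideanSpace ℝ (Fin n))).toSphere Set.univ ≤ ENNReal.ofReal M)
    (hdir : ∀ ξ : EuclideanSpace ℝ (Fin n), ‖ξ‖ = 1 → a ≤ dirNorm p g ξ) :
    ENNReal.ofReal (normConst n p) * (ENNReal.ofReal (M ^ (-(1 / (n : ℝ)))) * a) ≤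
      affineEnergy p g := by
  rcases eq_or_ne a 0 with rfl | ha0
  · simp
  have hn0 : (n : ℝ) ≠ 0 := by positivity
  unfold affineEnergy
  gcongr
  have hint : ∫⁻ ξ : Metric.sphere (0 : EuclideanSpace ℝ (Fin n)) 1,
      dirNorm p g (ξ : EuclideanSpace ℝ (Fin n)) ^ (-(n : ℝ))
        ∂(volume : Measure (EuclideanSpace ℝ (Fin n))).toSphere ≤
      a ^ (-(n : ℝ)) * ENNReal.ofReal M := by
    calc _ ≤ ∫⁻ _ : Metric.sphere (0 : EuclideanSpace ℝ (Fin n)) 1, a ^ (-(n : ℝ))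
          ∂(volume : Measure (EuclideanSpace ℝ (Fin n))).toSphere := by
          refine lintegral_mono fun ξ => ?_
          rw [ENNReal.rpow_neg, ENNReal.rpow_neg, ENNReal.inv_le_inv]
          exact ENNReal.rpow_le_rpow (hdir ξ (by simp)) (by positivity)
      _ ≤ _ := by
          rw [lintegral_const]
          gcongr
  have hrw : ENNReal.ofReal (M ^ (-(1 / (n : ℝ)))) * a =
      (a ^ (-(n : ℝ)) * ENNReal.ofReal M) ^ (-(1 / (n : ℝ))) := by
    rw [ENNReal.mul_rpow_of_ne_zero (by simp [ha, ha0]) (by simpa using hM), ← ENNReal.rpow_mul,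
      ENNReal.ofReal_rpow_of_pos hM, mul_comm]
    congr 1
    rw [neg_mul_neg, mul_one_div_cancel hn0, ENNReal.rpow_one]
  rw [hrw, ENNReal.rpow_neg _ (1 / (n : ℝ)), ENNReal.rpow_neg _ (1 / (n : ℝ)),
    ENNReal.inv_le_inv]
  exact ENNReal.rpow_le_rpow hint (by positivity)

/-- Functions of `W^{1,p}_0(Ω)` vanish almost everywhere outside `Ω`. -/
theorem IsW1pZero.isW1pVanishing {n : ℕ} {Ω : Set (EuclideanSpace ℝ (Fin n))}
    (hΩ : MeasurableSet Ω) {p : ℝ} (hp : 0 < p) {f : EuclideanSpace ℝ (Fin n) → ℝ}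
    {g : EuclideanSpace ℝ (Fin n) → EuclideanSpace ℝ (Fin n)} (h : IsW1pZero Ω p f g) :
    IsW1pVanishing Ω p f g := by
  refine ⟨h.toIsW1p, ?_⟩
  obtain ⟨φ, hφ, hlim, -⟩ := h.exists_approx
  have h0 : eLpNorm f (ENNReal.ofReal p) (volume.restrict Ωᶜ) = 0 := by
    -- Off `Ω` each approximant is zero, so the norm of `f` there is at most that of `φ k - f`.
    refine le_antisymm (ge_of_tendsto' hlim fun k => ?_) zero_le
    refine le_trans (le_of_eq ?_) (eLpNorm_mono_measure _
      (Measure.restrict_le_self (s := Ωᶜ)))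
    rw [← eLpNorm_neg]
    refine eLpNorm_congr_ae ?_
    filter_upwards [ae_restrict_mem hΩ.compl] with x hx
    have : φ k x = 0 := by
      by_contra h0
      exact hx ((hφ k).2.2 (subset_tsupport _ h0))
    simp [this]
  rw [eLpNorm_eq_zero_iff h.memLp.1.restrict (by simpa using hp)] at h0
  exact (ae_restrict_iff' hΩ.compl).1 h0

/-- The affine `L^p` Poincaré inequality for functions vanishing outside a ball. -/
theorem mul_lintegral_le_affineEnergy {n : ℕ} (hn : 1 ≤ n) {Ω : Set (EuclideanSpace ℝ (Fin n))}
    {R M : ℝ} (hR : 0 < R) (hΩR : Ω ⊆ Metric.ball 0 R) {p : ℝ} (hp : 1 ≤ p) (hM : 0 < M)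
    (hσ : (volume : Measure (EuclideanSpace ℝ (Fin n))).toSphere Set.univ ≤ ENNReal.ofReal M)
    {f : EuclideanSpace ℝ (Fin n) → ℝ}
    {g : EuclideanSpace ℝ (Fin n) → EuclideanSpace ℝ (Fin n)} (h : IsW1pVanishing Ω p f g) :
    ENNReal.ofReal ((normConst n p * (M ^ (-(1 / (n : ℝ))) / (2 * R))) ^ p) *
      ∫⁻ x in Ω, ‖f x‖ₑ ^ p ≤ affineEnergy p g ^ p := by
  have hp0 : 0 < p := by linarith
  have hc := normConst_pos hn hp
  have hdir (ξ : EuclideanSpace ℝ (Fin n)) (hξ : ‖ξ‖ = 1) :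
      eLpNorm f (ENNReal.ofReal p) volume / ENNReal.ofReal (2 * R) ≤ dirNorm p g ξ := by
    refine ENNReal.div_le_of_le_mul' (eLpNorm_le_mul_eLpNorm_weakDeriv hξ hR.le hp h.memLp
      (h.ae_eq_zero.mono fun x hx hxR => hx fun hxΩ => hxR (hΩR hxΩ))
      (h.memLp_grad.inner_const ξ) fun φ h1 h2 => h.weakGrad φ h1 h2 ξ)
  have hle := le_affineEnergy hn (ENNReal.div_ne_top h.memLp.2.ne (ENNReal.ofReal_pos.2 (by positivity)).ne') hM hσ hdir
  have hnorm : ∫⁻ x in Ω, ‖f x‖ₑ ^ p ≤ eLpNorm f (ENNReal.ofReal p) volume ^ p := by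
    rw [eLpNorm_eq_lintegral_rpow_enorm_toReal (by simpa using hp0) ENNReal.ofReal_ne_top,
      ENNReal.toReal_ofReal hp0.le, ← ENNReal.rpow_mul, one_div_mul_cancel hp0.ne',
      ENNReal.rpow_one]
    exact setLIntegral_le_lintegral _ _
  calc _ ≤ ENNReal.ofReal ((normConst n p * (M ^ (-(1 / (n : ℝ))) / (2 * R))) ^ p) *
        eLpNorm f (ENNReal.ofReal p) volume ^ p := by gcongr
    _ = (ENNReal.ofReal (normConst n p) * (ENNReal.ofReal (M ^ (-(1 / (n : ℝ)))) *
        (eLpNorm f (ENNReal.ofReal p) volume / ENNReal.ofReal (2 * R)))) ^ p := by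
        rw [← ENNReal.ofReal_rpow_of_nonneg (by positivity) hp0.le,
          ← ENNReal.mul_rpow_of_nonneg _ _ hp0.le, ENNReal.ofReal_mul hc.le,
          ENNReal.ofReal_div_of_pos (by positivity)]
        simp only [div_eq_mul_inv]
        ring_nf
    _ ≤ _ := ENNReal.rpow_le_rpow hle hp0.le

end AffinePoincare

/-- The affine `L^p` Poincaré inequality on a bounded open set `Ω ⊆ ℝⁿ`, for all `p ≥ 1`, with one
constant for both usual descriptions of the space of functions vanishing outside `Ω`: the closure
of `C_c^∞(Ω)`, and the functions of `W^{1,p}(ℝⁿ)` that vanish on `ℝⁿ ∖ Ω`. -/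
theorem theorem1p1 (n : ℕ) (hn : 1 ≤ n) (Ω : Set (EuclideanSpace ℝ (Fin n)))
    (hΩ_open : IsOpen Ω) (hΩ_bdd : Bornology.IsBounded Ω) (p : ℝ) (hp : 1 ≤ p) :
    ∃ K : ℝ, 0 < K ∧
      (∀ (f : EuclideanSpace ℝ (Fin n) → ℝ)
          (g : EuclideanSpace ℝ (Fin n) → EuclideanSpace ℝ (Fin n)),
        AffinePoincare.IsW1pZero Ω p f g →
          ENNReal.ofReal K * ∫⁻ x in Ω, ‖f x‖ₑ ^ p ≤ AffinePoincare.affineEnergy p g ^ p) ∧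
      (∀ (f : EuclideanSpace ℝ (Fin n) → ℝ)
          (g : EuclideanSpace ℝ (Fin n) → EuclideanSpace ℝ (Fin n)),
        AffinePoincare.IsW1pVanishing Ω p f g →
          ENNReal.ofReal K * ∫⁻ x in Ω, ‖f x‖ₑ ^ p ≤ AffinePoincare.affineEnergy p g ^ p) := by
  obtain ⟨R, hR, hΩR⟩ := hΩ_bdd.subset_ball_lt 0 0
  -- The added `1` gives positivity without computing the area of the sphere.
  set M : ℝ := ((volume : Measure (EuclideanSpace ℝ (Fin n))).toSphere Set.univ).toReal + 1 with hMdef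
  have hM : 0 < M := by positivity
  have hσ : (volume : Measure (EuclideanSpace ℝ (Fin n))).toSphere Set.univ ≤
      ENNReal.ofReal M := by
    rw [← ENNReal.ofReal_toReal (measure_ne_top (volume.toSphere) Set.univ)]
    exact ENNReal.ofReal_le_ofReal (by simp [hMdef])
  have hc := AffinePoincare.normConst_pos hn hp
  -- Unification takes `K` to be `(c_{n,p} M^{-1/n} / (2R))^p`.
  refine ⟨_, Real.rpow_pos_of_pos (by positivity) p, fun f g h => ?_, fun f g h =>
    AffinePoincare.mul_lintegral_le_affineEnergy hn hR hΩR hp hM hσ h⟩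
  exact AffinePoincare.mul_lintegral_le_affineEnergy hn hR hΩR hp hM hσ
    (h.isW1pVanishing hΩ_open.measurableSet (by linarith))
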